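/- \textbf{Corollary (Quillen, Guillemin).} Let $V$ and $W$ be finite-dimensional vector spaces over a field, $n=\dim V$, and let $A\subset \operatorname{Hom}(V,W)=W\otimes V^*$ be a tableau, that is, a linear subspace. For a basis $(u_1,\dots,u_n)$ of $V$ and a basis of $W$, regard the matrix entries $\pi\mapsto\pi^a_i$ of $\pi\in A$ (where column $i$ of $\pi$ is $\pi(u_i)$) as elements of $A^*$. The characters of $A$ relative to $(u_i)$ are the $n$ numbers whose $i$-th one is the dimension of the span in $A^*$ of the entries in columns $1,\dots,i$ minus the dimension of the span of the entries in columns $1,\dots,i-1$; they do not depend on the basis of $W$. The Cartan characters $(s_1,\dots,s_n)$ of $A$ are the lexicographic maximum of these tuples over all bases of $V$, and a basis of $V$ is called generic if it attains this maximum. Let $\ell$ be the largest index with $s_\ell>0$ ($\ell=0$ if $A=0$). The prolongation of $A$ is $A^{(1)}=\ker(\delta: A\otimes V^*\to W\otimes\wedge^2V^*)$, where $\delta$ is the inclusion $A\otimes V^*\subset W\otimes V^*\otimes V^*$ followed by skewing, and $A$ is called involutive if $\dim A^{(1)}=s_1+2s_2+\cdots+n s_n$ (which equals $s_1+2s_2+\cdots+\ell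 s_\ell$). Let $(u_1,\dots,u_n)$ be a generic basis of $V$, let $U=\langle u_1,\dots,u_\ell\rangle\subset V$, and let $A|_U=\{\pi|_U:\pi\in A\}\subset \operatorname{Hom}(U,W)$. If $A$ is involutive, then $A|_U$ is involutive (as a tableau in $W\otimes U^*$), and the natural map $A^{(1)}\to (A|_U)^{(1)}$, induced by restriction $A\otimes V^*\to A|_U\otimes U^*$, is bijective. -/

import Mathlib

open Module

namespace Tableau

noncomputable section

/-! A *tableau* is a linear subspace `A` of `W ⊗ V^* = Hom(V, W)`, that is, a term
`A : Submodule K (V →ₗ[K] W)`, where `V` and `W` are finite-dimensional vector spaces. -/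

section Characters

variable {K V W : Type*} [Field K] [AddCommGroup V] [Module K V] [AddCommGroup W] [Module K W]

/-- The linear functional `π ↦ θ (π v)` on a tableau. For a basis `(u_i)` of `V` and a basis `(z_a)`
of `W` with dual basis `(z^a)`, the functional `entry A (u i) (z^a)` is the matrix entry `π^a_i`,
considered as an element of `A^*`. -/
def entry (A : Submodule K (V →ₗ[K] W)) (v : V) (θ : Dual K W) : Dual K A :=
  θ ∘ₗ LinearMap.applyₗ v ∘ₗ A.subtype

/-- The span in `A^*` of all entries in the first `k` columns, with respect to a basis
`u` of `V`. It does not depend on a choice of basis of `W`. -/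
def entrySpan (A : Submodule K (V →ₗ[K] W)) {n : ℕ} (u : Basis (Fin n) K V) (k : ℕ) :
    Submodule K (Dual K A) :=
  Submodule.span K {f | ∃ (i : Fin n) (θ : Dual K W), i.val < k ∧ f = entry A (u i) θ}

/-- The Cartan characters of `A` relative to the basis `u` of `V` (equivalently, relative to the
dual basis of `V^*`): the value at `i` is the number of new independent entries that occur in
column `i`. Columns are numbered from `0`. -/
def basisCharacters (A : Submodule K (V →ₗ[K] W)) {n : ℕ} (u : Basis (Fin n) K V) : Fin n → ℕ :=
  fun i => finrank K (entrySpan A u (i.val + 1)) - finrank K (entrySpan A u i.val)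

/-- A basis is generic for `A` if its characters are the lexicographic maximum of the characters
over all bases. -/
def IsGeneric (A : Submodule K (V →ₗ[K] W)) {n : ℕ} (u : Basis (Fin n) K V) : Prop :=
  ∀ u' : Basis (Fin n) K V, toLex (basisCharacters A u') ≤ toLex (basisCharacters A u)

variable [FiniteDimensional K V] [FiniteDimensional K W]

theorem exists_isGeneric (A : Submodule K (V →ₗ[K] W)) :
    ∃ u : Basis (Fin (finrank K V)) K V, IsGeneric A u := by
  let f : Basis (Fin (finrank K V)) K V → (Fin (finrank K V) → ℕ) := fun u => basisCharacters A u
  have hfin : (Set.range f).Finite := by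
    refine (Set.finite_Iic (fun _ => finrank K (Dual K A))).subset ?_
    rintro _ ⟨u, rfl⟩ i
    exact (Nat.sub_le _ _).trans (Submodule.finrank_le _)
  obtain ⟨_, ⟨u, rfl⟩, hu⟩ := Set.exists_max_image (Set.range f) toLex hfin
    ⟨_, ⟨finBasis K V, rfl⟩⟩
  exact ⟨u, fun u' => hu _ ⟨u', rfl⟩⟩

/-- The Cartan characters `(s_1, …, s_n)` of `A`: the lexicographic maximum of the characters over
all bases of `V`, attained exactly at the generic bases. -/
def cartanCharacters (A : Submodule K (V →ₗ[K] W)) : Fin (finrank K V) → ℕ :=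
  basisCharacters A (exists_isGeneric A).choose

theorem isGeneric_iff (A : Submodule K (V →ₗ[K] W)) (u : Basis (Fin (finrank K V)) K V) :
    IsGeneric A u ↔ basisCharacters A u = cartanCharacters A := by
  have h := (exists_isGeneric A).choose_spec
  constructor
  · intro hu
    exact toLex.injective (le_antisymm (h u) (hu _))
  · intro hu u'
    rw [hu]
    exact h u'

/-- The character `ℓ` of `A`: the number (counted from `1`) of the last column with `s_ℓ > 0`, and
`0` if there is no such column. -/
def character (A : Submodule K (V →ₗ[K] W)) : ℕ :=
  (Finset.univ.filter fun i => 0 < cartanCharacters A i).sup fun i => i.val + 1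

end Characters

section Prolongation

variable {K V W : Type*} [Field K] [AddCommGroup V] [Module K V] [AddCommGroup W] [Module K W]

/-- The skewing map `δ : A ⊗ V^* → W ⊗ Λ² V^*`. Here `A ⊗ V^*` is `Hom(V, A)`, where `π ⊗ φ` is
`v ↦ φ(v) π`, and `W ⊗ Λ² V^*` is the space of alternating bilinear maps from `V` to `W`. -/
def skew (A : Submodule K (V →ₗ[K] W)) : (V →ₗ[K] A) →ₗ[K] (V [⋀^Fin 2]→ₗ[K] W) where
  toFun P :=
    { toFun := fun x => (P (x 1) : V →ₗ[K] W) (x 0) - (P (x 0) : V →ₗ[K] W) (x 1)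
      map_update_add' := by
        intro inst x i v w
        obtain rfl : inst = instDecidableEqFin 2 := Subsingleton.elim _ _
        fin_cases i <;> simp <;> abel
      map_update_smul' := by
        intro inst x i c v
        obtain rfl : inst = instDecidableEqFin 2 := Subsingleton.elim _ _
        fin_cases i <;> simp [smul_sub]
      map_eq_zero_of_eq' := by
        intro x i j hx hij
        have h : x 0 = x 1 := by
          fin_cases i <;> fin_cases j <;> simp_all
        simp [h] }
  map_add' P Q := by
    ext x
    simp only [AlternatingMap.coe_mk, MultilinearMap.coe_mk, AlternatingMap.add_apply,
      LinearMap.add_apply, Submodule.coe_add]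
    abel
  map_smul' c P := by
    ext x
    simp [smul_sub]

theorem skew_apply (A : Submodule K (V →ₗ[K] W)) (P : V →ₗ[K] A) (x : Fin 2 → V) :
    skew A P x = (P (x 1) : V →ₗ[K] W) (x 0) - (P (x 0) : V →ₗ[K] W) (x 1) :=
  rfl

/-- The prolongation `A^{(1)} = ker (δ : A ⊗ V^* → W ⊗ Λ² V^*)`. -/
def prolongation (A : Submodule K (V →ₗ[K] W)) : Submodule K (V →ₗ[K] A) :=
  LinearMap.ker (skew A)

theorem mem_prolongation (A : Submodule K (V →ₗ[K] W)) (P : V →ₗ[K] A) :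
    P ∈ prolongation A ↔ ∀ v w : V, (P v : V →ₗ[K] W) w = (P w : V →ₗ[K] W) v := by
  rw [prolongation, LinearMap.mem_ker]
  constructor
  · intro h v w
    have h' := skew_apply A P ![w, v]
    rw [h] at h'
    simpa using sub_eq_zero.1 h'.symm
  · intro h
    ext x
    rw [skew_apply, h (x 1) (x 0), sub_self, AlternatingMap.zero_apply]

/-- The restricted tableau `A|_U = {π|_U : π ∈ A}` in `Hom(U, W)`. -/
def restrict (A : Submodule K (V →ₗ[K] W)) (U : Submodule K V) : Submodule K (U →ₗ[K] W) :=
  A.map (LinearMap.lcomp K W U.subtype)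

/-- The restriction map `A → A|_U`, `π ↦ π|_U`. -/
def restrictMap (A : Submodule K (V →ₗ[K] W)) (U : Submodule K V) : A →ₗ[K] restrict A U :=
  (LinearMap.lcomp K W U.subtype).submoduleMap A

theorem restrictMap_apply (A : Submodule K (V →ₗ[K] W)) (U : Submodule K V) (π : A) (x : U) :
    (restrictMap A U π : U →ₗ[K] W) x = (π : V →ₗ[K] W) x :=
  rfl

/-- The natural map `A^{(1)} → (A|_U)^{(1)}`, induced by the restriction map
`A ⊗ V^* → A|_U ⊗ U^*`: it sends `P` to `x ↦ (P x)|_U` for `x ∈ U`. -/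
def prolongationRestrict (A : Submodule K (V →ₗ[K] W)) (U : Submodule K V) :
    prolongation A →ₗ[K] prolongation (restrict A U) where
  toFun P :=
    ⟨restrictMap A U ∘ₗ (P : V →ₗ[K] A) ∘ₗ U.subtype, (mem_prolongation _ _).2 fun x y =>
      (mem_prolongation A P).1 P.2 x y⟩
  map_add' P Q := by
    ext x
    simp
  map_smul' c P := by
    ext x
    simp

theorem prolongationRestrict_apply (A : Submodule K (V →ₗ[K] W)) (U : Submodule K V)
    (P : prolongation A) (x y : U) :
    (((prolongationRestrict A U P : U →ₗ[K] restrict A U) x : restrict A U) : U →ₗ[K] W) y =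
      (((P : V →ₗ[K] A) x : A) : V →ₗ[K] W) y :=
  rfl

end Prolongation

section Involutive

variable {K V W : Type*} [Field K] [AddCommGroup V] [Module K V] [AddCommGroup W] [Module K W]
  [FiniteDimensional K V] [FiniteDimensional K W]

/-- Cartan's test: `A` is involutive if `s_1 + 2 s_2 + ⋯ + n s_n = dim A^{(1)}`. -/
def IsInvolutive (A : Submodule K (V →ₗ[K] W)) : Prop :=
  ∑ i : Fin (finrank K V), (i.val + 1) * cartanCharacters A i = finrank K (prolongation A)

/-- The subspace `U = ⟨u_1, …, u_ℓ⟩` spanned by the first `ℓ` vectors of a basis of `V`, where `ℓ`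
is the character of `A`. -/
def characterSpan (A : Submodule K (V →ₗ[K] W)) {n : ℕ} (u : Basis (Fin n) K V) :
    Submodule K V :=
  Submodule.span K {v | ∃ i : Fin n, i.val < character A ∧ v = u i}

end Involutive

end

end Tableau

namespace Tableau

section

variable {K V W : Type*} [Field K] [AddCommGroup V] [Module K V] [AddCommGroup W] [Module K W]

/-! Let `A_k` be the elements of `A` killing the first `k` basis vectors. The span of the first `k`
columns of entries has dimension `dim A - dim A_k`, so for every basis the weighted sum of
characters telescopes to `∑_{k<n} dim A_k`. Filtering the prolongation in the same way gives
Cartan's inequality: `dim A^{(1)}` is at most this sum (`finrank_prolongation_le`).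

For a generic basis the characters beyond `ℓ` vanish, so `A_ℓ = 0` and `A → A|_U` is an isomorphism
preserving the first `ℓ` characters. The truncated basis is generic for `A|_U`
(`IsGeneric.restrict`), and the symmetry of prolongation elements makes `A^{(1)} → (A|_U)^{(1)}`
injective. Hence `dim A^{(1)} ≤ dim (A|_U)^{(1)} ≤ ∑ i s_i`; involutivity of `A` makes the ends
equal, which gives both claims. -/

theorem _root_.Submodule.finrank_le_add_of_map_le_of_inf_ker_le
    {K E F : Type*} [Field K] [AddCommMonoid E] [Module K E] [Module.Finite K E]
    [AddCommMonoid F] [Module K F] [Module.Finite K F] {p r : Submodule K E}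
    {q : Submodule K F} (f : E →ₗ[K] F) (hq : p.map f ≤ q) (hr : p ⊓ LinearMap.ker f ≤ r) :
    Module.finrank K p ≤ Module.finrank K q + Module.finrank K r := by
  let _ : AddCommGroup E := Module.addCommMonoidToAddCommGroup K
  let _ : AddCommGroup F := Module.addCommMonoidToAddCommGroup K
  rw [← (f.domRestrict p).finrank_range_add_finrank_ker, LinearMap.range_domRestrict]
  refine add_le_add (Submodule.finrank_mono hq) ?_
  rw [LinearMap.ker_domRestrict, ← Submodule.finrank_map_subtype_eq,
    Submodule.map_comap_subtype]
  exact Submodule.finrank_mono hr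

theorem _root_.Submodule.surjective_of_injective_of_finrank_eq
    {K E F : Type*} [Field K] [AddCommMonoid E] [Module K E] [Module.Finite K E]
    [AddCommMonoid F] [Module K F] [Module.Finite K F] {p : Submodule K E}
    {q : Submodule K F} {f : p →ₗ[K] q} (hf : Function.Injective f)
    (h : Module.finrank K p = Module.finrank K q) : Function.Surjective f := by
  let _ : AddCommGroup E := Module.addCommMonoidToAddCommGroup K
  let _ : AddCommGroup F := Module.addCommMonoidToAddCommGroup K
  exact (LinearMap.injective_iff_surjective_of_finrank_eq_finrank h).1 hf

/-! ### Characters as codimension jumps -/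

/-- The elements of a tableau whose first `k` columns vanish. -/
def vanishing (A : Submodule K (V →ₗ[K] W)) {n : ℕ} (u : Module.Basis (Fin n) K V) (k : ℕ) :
    Submodule K A where
  carrier := {π | ∀ i : Fin n, i.val < k → (π : V →ₗ[K] W) (u i) = 0}
  add_mem' := by
    intro a b ha hb i hi
    simp [ha i hi, hb i hi]
  zero_mem' := by
    intro i _
    simp
  smul_mem' := by
    intro c a ha i hi
    simp [ha i hi]

theorem mem_vanishing {A : Submodule K (V →ₗ[K] W)} {n : ℕ} {u : Module.Basis (Fin n) K V}
    {k : ℕ} {π : A} :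
    π ∈ vanishing A u k ↔ ∀ i : Fin n, i.val < k → (π : V →ₗ[K] W) (u i) = 0 :=
  Iff.rfl

theorem vanishing_antitone (A : Submodule K (V →ₗ[K] W)) {n : ℕ}
    (u : Module.Basis (Fin n) K V) : Antitone (vanishing A u) :=
  fun _ _ h _ hπ i hi => hπ i (hi.trans_le h)

theorem vanishing_of_le (A : Submodule K (V →ₗ[K] W)) {n : ℕ}
    (u : Module.Basis (Fin n) K V) {k : ℕ} (hk : n ≤ k) : vanishing A u k = ⊥ := by
  refine (Submodule.eq_bot_iff _).2 fun π hπ => ?_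
  exact Subtype.ext (u.ext fun i => by simpa using hπ i (i.isLt.trans_le hk))

/-- Functionals on `W` separate points, so the common zeros of a column's entries are the elements
whose column is zero. -/
theorem dualCoannihilator_entrySpan (A : Submodule K (V →ₗ[K] W)) {n : ℕ}
    (u : Module.Basis (Fin n) K V) (k : ℕ) :
    (entrySpan A u k).dualCoannihilator = vanishing A u k := by
  ext π
  rw [Submodule.mem_dualCoannihilator, mem_vanishing]
  constructor
  · intro h i hi
    refine (Module.forall_dual_apply_eq_zero_iff K _).1 fun θ => ?_
    exact h (entry A (u i) θ) (Submodule.subset_span ⟨i, θ, hi, rfl⟩)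
  · intro h f hf
    induction hf using Submodule.span_induction with
    | mem f hf =>
      obtain ⟨i, θ, hi, rfl⟩ := hf
      simp [entry, h i hi]
    | zero => simp
    | add f g _ _ hf hg => simp [hf, hg]
    | smul c f _ hf => simp [hf]

variable [FiniteDimensional K V] [FiniteDimensional K W]

theorem finrank_entrySpan_add (A : Submodule K (V →ₗ[K] W)) {n : ℕ}
    (u : Module.Basis (Fin n) K V) (k : ℕ) :
    Module.finrank K (entrySpan A u k) + Module.finrank K (vanishing A u k) =
      Module.finrank K A := by
  rw [← dualCoannihilator_entrySpan]
  exact Subspace.finrank_add_finrank_dualCoannihilator_eq _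

theorem basisCharacters_eq (A : Submodule K (V →ₗ[K] W)) {n : ℕ}
    (u : Module.Basis (Fin n) K V) (i : Fin n) :
    basisCharacters A u i = Module.finrank K (vanishing A u i) -
      Module.finrank K (vanishing A u (i + 1)) := by
  have h₁ := finrank_entrySpan_add A u i
  have h₂ := finrank_entrySpan_add A u (i + 1)
  have h₃ := Submodule.finrank_mono (vanishing_antitone A u (Nat.le_succ i.val))
  rw [basisCharacters]
  simp only [Nat.succ_eq_add_one] at h₃
  omega

theorem vanishing_eq_bot_of_basisCharacters_eq_zero (A : Submodule K (V →ₗ[K] W)) {n l : ℕ}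
    (u : Module.Basis (Fin n) K V) (h : ∀ i : Fin n, l ≤ i.val → basisCharacters A u i = 0) :
    vanishing A u l = ⊥ := by
  have key : ∀ m, Module.finrank K (vanishing A u l) ≤
      Module.finrank K (vanishing A u (l + m)) := by
    intro m
    induction m with
    | zero => exact le_rfl
    | succ m ih =>
      by_cases hm : l + m < n
      · have h' := h ⟨l + m, hm⟩ (Nat.le_add_right _ _)
        rw [basisCharacters_eq] at h'
        exact ih.trans (Nat.sub_eq_zero_iff_le.1 h')
      -- Past the last column the space is already zero, so `ih` bounds the dimension by zero.
      · rw [vanishing_of_le A u (not_lt.1 hm), finrank_bot] at ih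
        exact ih.trans (Nat.zero_le _)
  have hn := key n
  rw [vanishing_of_le A u (Nat.le_add_left _ _), finrank_bot] at hn
  exact Submodule.finrank_eq_zero.1 (Nat.le_zero.1 hn)

theorem basisCharacters_eq_zero_of_vanishing_eq_bot (A : Submodule K (V →ₗ[K] W)) {n l : ℕ}
    (u : Module.Basis (Fin n) K V) (h : vanishing A u l = ⊥) (i : Fin n) (hi : l ≤ i.val) :
    basisCharacters A u i = 0 := by
  have h' : vanishing A u i = ⊥ := le_bot_iff.1 (h ▸ vanishing_antitone A u hi)
  rw [basisCharacters_eq, h', finrank_bot, Nat.zero_sub]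

/-- Abel summation; monotonicity makes the truncated differences genuine. -/
theorem _root_.Antitone.sum_range_succ_mul_sub {d : ℕ → ℕ} (hd : Antitone d) (n : ℕ) :
    ∑ i ∈ Finset.range n, (i + 1) * (d i - d (i + 1)) + n * d n =
      ∑ i ∈ Finset.range n, d i := by
  induction n with
  | zero => simp
  | succ n ih =>
    rw [Finset.sum_range_succ, Finset.sum_range_succ, ← ih]
    obtain ⟨c, hc⟩ := Nat.exists_eq_add_of_le (hd (Nat.le_succ n))
    simp only [Nat.succ_eq_add_one] at hc
    rw [hc, Nat.add_sub_cancel_left]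
    ring

theorem sum_basisCharacters (A : Submodule K (V →ₗ[K] W)) {n : ℕ}
    (u : Module.Basis (Fin n) K V) :
    ∑ i : Fin n, (i.val + 1) * basisCharacters A u i =
      ∑ k ∈ Finset.range n, Module.finrank K (vanishing A u k) := by
  have h := Antitone.sum_range_succ_mul_sub
    (d := fun k => Module.finrank K (vanishing A u k))
    (fun _ _ h => Submodule.finrank_mono (vanishing_antitone A u h)) n
  rw [← h, vanishing_of_le A u le_rfl, finrank_bot, mul_zero, add_zero,
    ← Fin.sum_univ_eq_sum_range (fun i => (i + 1) * (Module.finrank K (vanishing A u i) -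
      Module.finrank K (vanishing A u (i + 1))))]
  simp only [basisCharacters_eq]

/-! ### Cartan's inequality -/

/-- The elements of the prolongation that vanish on the first `k` basis vectors. -/
noncomputable def prolongationVanishing (A : Submodule K (V →ₗ[K] W)) {n : ℕ} (u : Module.Basis (Fin n) K V)
    (k : ℕ) : Submodule K (V →ₗ[K] A) :=
  prolongation A ⊓ ⨅ i : Fin n, ⨅ _ : i.val < k, LinearMap.ker (LinearMap.applyₗ (u i))

omit [FiniteDimensional K V] [FiniteDimensional K W] in
theorem mem_prolongationVanishing {A : Submodule K (V →ₗ[K] W)} {n : ℕ}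
    {u : Module.Basis (Fin n) K V} {k : ℕ} {P : V →ₗ[K] A} :
    P ∈ prolongationVanishing A u k ↔
      P ∈ prolongation A ∧ ∀ i : Fin n, i.val < k → P (u i) = 0 := by
  simp [prolongationVanishing, Submodule.mem_iInf]

theorem finrank_prolongationVanishing_le (A : Submodule K (V →ₗ[K] W)) {n : ℕ}
    (u : Module.Basis (Fin n) K V) {k : ℕ} (hk : k < n) :
    Module.finrank K (prolongationVanishing A u k) ≤
      Module.finrank K (vanishing A u k) +
        Module.finrank K (prolongationVanishing A u (k + 1)) := by
  refine Submodule.finrank_le_add_of_map_le_of_inf_ker_le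
    (LinearMap.applyₗ (u ⟨k, hk⟩)) ?_ ?_
  · rintro _ ⟨P, hP, rfl⟩ i hi
    obtain ⟨h₁, h₂⟩ := mem_prolongationVanishing.1 hP
    -- By symmetry `P(u_k)(u_i) = P(u_i)(u_k) = 0` for `i < k`, so `P(u_k)` lies in `A_k`.
    rw [LinearMap.applyₗ_apply_apply, (mem_prolongation A _).1 h₁, h₂ i hi]
    simp
  · rintro P ⟨hP, hPk⟩
    obtain ⟨h₁, h₂⟩ := mem_prolongationVanishing.1 hP
    refine mem_prolongationVanishing.2 ⟨h₁, fun i hi => ?_⟩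
    rcases Nat.lt_succ_iff_lt_or_eq.1 hi with h | h
    · exact h₂ i h
    · obtain rfl : i = ⟨k, hk⟩ := Fin.ext h
      exact hPk

theorem finrank_prolongation_le (A : Submodule K (V →ₗ[K] W)) {n : ℕ}
    (u : Module.Basis (Fin n) K V) :
    Module.finrank K (prolongation A) ≤ ∑ i : Fin n, (i.val + 1) * basisCharacters A u i := by
  have key : ∀ m ≤ n, Module.finrank K (prolongation A) ≤
      ∑ k ∈ Finset.range m, Module.finrank K (vanishing A u k) +
        Module.finrank K (prolongationVanishing A u m) := by
    intro m
    induction m with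
    | zero =>
      refine fun _ => le_add_left (Submodule.finrank_mono fun P hP => ?_)
      exact mem_prolongationVanishing.2 ⟨hP, fun i hi => absurd hi (Nat.not_lt_zero _)⟩
    | succ m ih =>
      intro hm
      have h₁ := ih (Nat.le_of_succ_le hm)
      have h₂ := finrank_prolongationVanishing_le A u (k := m) hm
      rw [Finset.sum_range_succ]
      omega
  have hbot : prolongationVanishing A u n = ⊥ :=
    (Submodule.eq_bot_iff _).2 fun P hP =>
      u.ext fun i => by simpa using (mem_prolongationVanishing.1 hP).2 i i.isLt
  have h := key n le_rfl
  rwa [hbot, finrank_bot, add_zero, ← sum_basisCharacters] at h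

/-! ### Generic bases and restriction to a subspace -/

theorem IsGeneric.sum_cartanCharacters {A : Submodule K (V →ₗ[K] W)} {n : ℕ}
    {u : Module.Basis (Fin n) K V} (hu : IsGeneric A u) :
    ∑ i : Fin (Module.finrank K V), (i.val + 1) * cartanCharacters A i =
      ∑ i : Fin n, (i.val + 1) * basisCharacters A u i := by
  have hn : n = Module.finrank K V := by
    rw [Module.finrank_eq_card_basis u, Fintype.card_fin]
  subst hn
  rw [(isGeneric_iff A u).1 hu]

theorem character_le (A : Submodule K (V →ₗ[K] W)) : character A ≤ Module.finrank K V :=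
  Finset.sup_le fun i _ => i.isLt

theorem IsGeneric.basisCharacters_eq_zero {A : Submodule K (V →ₗ[K] W)} {n : ℕ}
    {u : Module.Basis (Fin n) K V} (hu : IsGeneric A u) (i : Fin n) (hi : character A ≤ i.val) :
    basisCharacters A u i = 0 := by
  have hn : n = Module.finrank K V := by
    rw [Module.finrank_eq_card_basis u, Fintype.card_fin]
  subst hn
  rw [(isGeneric_iff A u).1 hu]
  by_contra h
  have h' : i.val + 1 ≤ character A :=
    Finset.le_sup (f := fun i : Fin (Module.finrank K V) => i.val + 1)
      (Finset.mem_filter.2 ⟨Finset.mem_univ i, Nat.pos_of_ne_zero h⟩)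
  omega

omit [FiniteDimensional K V] [FiniteDimensional K W] in
theorem restrictMap_surjective (A : Submodule K (V →ₗ[K] W)) (U : Submodule K V) :
    Function.Surjective (restrictMap A U) :=
  LinearMap.submoduleMap_surjective _ _

omit [FiniteDimensional K V] in
-- The tail of `u` is kept: together with `w` it still spans, and it has the right number of
-- vectors.
theorem exists_basis_extend {l m : ℕ} (u : Module.Basis (Fin (l + m)) K V) {U : Submodule K V}
    (hU : ∀ i : Fin l, u (Fin.castAdd m i) ∈ U) (w : Module.Basis (Fin l) K U) :
    ∃ w' : Module.Basis (Fin (l + m)) K V, ∀ i : Fin l, w' (Fin.castAdd m i) = w i := by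
  let b : Fin (l + m) → V := Fin.addCases (fun i => (w i : V)) (fun j => u (Fin.natAdd l j))
  have hb : ∀ i : Fin l, b (Fin.castAdd m i) = w i := fun i => Fin.addCases_left i
  have hb' : ∀ j : Fin m, b (Fin.natAdd l j) = u (Fin.natAdd l j) := fun j => Fin.addCases_right j
  have hUb : U ≤ Submodule.span K (Set.range b) := by
    rw [← Submodule.map_subtype_top U, ← w.span_eq, Submodule.map_span, Submodule.span_le]
    rintro _ ⟨_, ⟨i, rfl⟩, rfl⟩
    exact Submodule.subset_span ⟨_, hb i⟩
  have hspan : ⊤ ≤ Submodule.span K (Set.range b) := by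
    rw [← u.span_eq, Submodule.span_le]
    rintro _ ⟨i, rfl⟩
    induction i using Fin.addCases with
    | left i => exact hUb (hU i)
    | right j => exact Submodule.subset_span ⟨_, hb' j⟩
  refine ⟨basisOfTopLeSpanOfCardEqFinrank b hspan (Module.finrank_eq_card_basis u).symm,
    fun i => ?_⟩
  rw [coe_basisOfTopLeSpanOfCardEqFinrank, hb]

omit [FiniteDimensional K V] [FiniteDimensional K W] in
theorem comap_restrictMap_vanishing (A : Submodule K (V →ₗ[K] W)) {l m k : ℕ} (hk : k ≤ l)
    {U : Submodule K V} {w' : Module.Basis (Fin (l + m)) K V} {w : Module.Basis (Fin l) K U}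
    (hw : ∀ i : Fin l, w' (Fin.castAdd m i) = w i) :
    (vanishing (restrict A U) w k).comap (restrictMap A U) = vanishing A w' k := by
  ext π
  rw [Submodule.mem_comap, mem_vanishing, mem_vanishing]
  constructor
  · intro h i hi
    rw [← h ⟨i, hi.trans_le hk⟩ hi, restrictMap_apply, ← hw]
    rfl
  · intro h i hi
    rw [restrictMap_apply, ← hw]
    exact h _ hi

theorem basisCharacters_restrict (A : Submodule K (V →ₗ[K] W)) {l m : ℕ}
    {U : Submodule K V} (hinj : Function.Injective (restrictMap A U))
    {w' : Module.Basis (Fin (l + m)) K V} {w : Module.Basis (Fin l) K U}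
    (hw : ∀ i : Fin l, w' (Fin.castAdd m i) = w i) (i : Fin l) :
    basisCharacters (restrict A U) w i = basisCharacters A w' (Fin.castAdd m i) := by
  let e := LinearEquiv.ofBijective (restrictMap A U) ⟨hinj, restrictMap_surjective A U⟩
  have key : ∀ k ≤ l, Module.finrank K (vanishing (restrict A U) w k) =
      Module.finrank K (vanishing A w' k) := by
    intro k hk
    rw [← comap_restrictMap_vanishing A hk hw, ← LinearEquiv.finrank_map_eq e]
    have h := Submodule.map_comap_eq_of_surjective (restrictMap_surjective A U)
      (vanishing (restrict A U) w k)
    exact congrArg (fun p : Submodule K (restrict A U) => Module.finrank K p) h.symm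
  rw [basisCharacters_eq, basisCharacters_eq, key _ i.isLt.le, key _ i.isLt]
  rfl

omit [FiniteDimensional K V] [FiniteDimensional K W] in
theorem prolongationRestrict_injective {A : Submodule K (V →ₗ[K] W)} {U : Submodule K V}
    (hinj : Function.Injective (restrictMap A U)) :
    Function.Injective (prolongationRestrict A U) := by
  intro P Q hPQ
  have hP := (mem_prolongation A P).1 P.2
  have hQ := (mem_prolongation A Q).1 Q.2
  have h₀ : ∀ x : U, (P : V →ₗ[K] A) x = (Q : V →ₗ[K] A) x := by
    refine fun x => hinj (Subtype.ext (LinearMap.ext fun y => ?_))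
    rw [restrictMap_apply, restrictMap_apply, ← prolongationRestrict_apply A U P x y, hPQ,
      prolongationRestrict_apply]
  refine Subtype.ext (LinearMap.ext fun v => hinj (Subtype.ext (LinearMap.ext fun x => ?_)))
  -- Symmetry turns `P(v)(x)` into `P(x)(v)` with `x` in `U`, where `P` and `Q` agree.
  rw [restrictMap_apply, restrictMap_apply, hP, hQ, h₀]

/-- A competing basis of `U` extends to `V` with the same first `l` characters, so genericity of `u`
decides the comparison. -/
theorem IsGeneric.restrict {A : Submodule K (V →ₗ[K] W)} {l m : ℕ}
    {u : Module.Basis (Fin (l + m)) K V} (hu : IsGeneric A u)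
    {U : Submodule K V} (hinj : Function.Injective (restrictMap A U))
    {w : Module.Basis (Fin l) K U} (hw : ∀ i : Fin l, u (Fin.castAdd m i) = w i) :
    IsGeneric (restrict A U) w := by
  intro w₁
  obtain ⟨u₁, hu₁⟩ := exists_basis_extend u (fun i => hw i ▸ (w i).2) w₁
  have hbot : vanishing A u l = ⊥ := by
    rw [← comap_restrictMap_vanishing A le_rfl hw, vanishing_of_le _ _ le_rfl]
    exact LinearMap.ker_eq_bot.2 hinj
  rcases (hu u₁).eq_or_lt with h | h
  · refine le_of_eq (congrArg toLex (funext fun i => ?_))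
    rw [basisCharacters_restrict A hinj hu₁, basisCharacters_restrict A hinj hw]
    exact congrFun (toLex.injective h) _
  · obtain ⟨i, hi, hlt⟩ := h
    refine le_of_lt ?_
    induction i using Fin.addCases with
    | left i =>
      refine ⟨i, fun j hj => ?_, ?_⟩
      · have h := hi (Fin.castAdd m j) hj
        simpa [basisCharacters_restrict A hinj hu₁, basisCharacters_restrict A hinj hw] using h
      · simpa [basisCharacters_restrict A hinj hu₁, basisCharacters_restrict A hinj hw] using hlt
    | right j =>
      -- The first difference cannot occur beyond `l`: there the larger tuple is zero.
      have h₀ := basisCharacters_eq_zero_of_vanishing_eq_bot A u hbot (Fin.natAdd l j)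
        (Nat.le_add_right _ _)
      exact absurd hlt (by simp [h₀])

end

end Tableau

theorem mainTheorem3 {K V W : Type*} [Field K] [AddCommGroup V] [Module K V]
    [FiniteDimensional K V] [AddCommGroup W] [Module K W] [FiniteDimensional K W]
    (A : Submodule K (V →ₗ[K] W)) {n : ℕ} (u : Module.Basis (Fin n) K V)
    (hu : Tableau.IsGeneric A u) (hA : Tableau.IsInvolutive A) :
    Tableau.IsInvolutive (Tableau.restrict A (Tableau.characterSpan A u)) ∧
      Function.Bijective (Tableau.prolongationRestrict A (Tableau.characterSpan A u)) := by
  have hn : n = Module.finrank K V := by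
    rw [Module.finrank_eq_card_basis u, Fintype.card_fin]
  obtain ⟨m, rfl⟩ := Nat.exists_eq_add_of_le (hn ▸ Tableau.character_le A)
  set U := Tableau.characterSpan A u with hU
  have hzero := hu.basisCharacters_eq_zero
  have hbot := Tableau.vanishing_eq_bot_of_basisCharacters_eq_zero A u hzero
  have hrange : U = Submodule.span K (Set.range (u ∘ Fin.castAdd m)) := by
    rw [hU, Tableau.characterSpan]
    congr 1
    ext v
    constructor
    · rintro ⟨i, hi, rfl⟩
      exact ⟨⟨i, hi⟩, rfl⟩
    · rintro ⟨i, rfl⟩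
      exact ⟨Fin.castAdd m i, i.isLt, rfl⟩
  have hmem : ∀ i, u (Fin.castAdd m i) ∈ U := fun i =>
    hrange ▸ Submodule.subset_span ⟨i, rfl⟩
  have hinj : Function.Injective (Tableau.restrictMap A U) := by
    refine (injective_iff_map_eq_zero _).2 fun π hπ => ?_
    rw [← Submodule.mem_bot K, ← hbot]
    intro i hi
    have h := Tableau.restrictMap_apply A U π ⟨u i, hmem ⟨i, hi⟩⟩
    rw [hπ] at h
    simpa using h.symm
  let w : Module.Basis (Fin (Tableau.character A)) K U :=
    (Module.Basis.span (u.linearIndependent.comp _ (Fin.castAdd_injective _ m))).map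
      (LinearEquiv.ofEq _ _ hrange.symm)
  have hw : ∀ i, u (Fin.castAdd m i) = w i := by
    intro i
    simp [w, Module.Basis.span_apply]
  have hsum := (hu.restrict hinj hw).sum_cartanCharacters
  have hsum' : ∑ i, (i.val + 1) * Tableau.basisCharacters (Tableau.restrict A U) w i =
      Module.finrank K (Tableau.prolongation A) := by
    -- The `m` columns after the first `ℓ` contribute nothing.
    rw [← hA, hu.sum_cartanCharacters, Fin.sum_univ_add]
    simp [hzero, Tableau.basisCharacters_restrict A hinj hw]
  have hle := Tableau.finrank_prolongation_le (Tableau.restrict A U) w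
  have hinj' := Tableau.prolongationRestrict_injective hinj
  have hge := LinearMap.finrank_le_finrank_of_injective hinj'
  have heq := le_antisymm hge (hle.trans_eq hsum')
  refine ⟨?_, hinj', Submodule.surjective_of_injective_of_finrank_eq hinj' heq⟩
  rw [Tableau.IsInvolutive, hsum, hsum', heq]
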